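/- Let $\mathbb S=\{v\in\mathbb H: v^2=-1\}$. For $z=(z_0,\dots,z_3)\in\mathbb C^4$, $z_m=x_m+\iota y_m$ with $x_m,y_m\in\mathbb R$, and $v\in\mathbb S$ put $\rho_v(z)=\sum_{m=0}^3 (x_m+v y_m)e_m\in\mathbb H$, where $(e_0,e_1,e_2,e_3)=(1,i,j,k)$. For $q=q_0+q_1i+q_2j+q_3k\in\mathbb H$ (identified with $(q_0,q_1,q_2,q_3)\in\mathbb R^4\subset\mathbb C^4$) let $Z(q)=\{z\in\mathbb C^4:\ \exists v\in\mathbb S,\ \rho_v(z)=q\}$. (1) For every $q\in\mathbb H$, $Z(q)$ is the zero locus of $\Phi_q(z)=\sum_{m=0}^3(z_m-q_m)^2$. (2) For every $q\in\mathbb H$, $\mathbb C^4\setminus Z(q)$ is path connected and $\pi_1(\mathbb C^4\setminus Z(q))\cong\mathbb Z$ (at every base point). (3) Let $\mathcal U\subseteq\mathbb C$ be a (non-empty, connected) open domain invariant under conjugation, let $U=\{x+vy:\ x+\iota y\in\mathcal U,\ v\in\mathbb S\}$, and let $f:U\to\mathbb H$ be slice-regular, that is, $f(x+vy)=\alpha(x,y)+v\beta(x,y)$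 for real differentiable $\alpha,\beta:\mathcal U\to\mathbb H$ with $\alpha(x,-y)=\alpha(x,y)$, $\beta(x,-y)=-\beta(x,y)$, $\partial_x\alpha=\partial_y\beta$, $\partial_y\alpha=-\partial_x\beta$. There is a unique holomorphic $F:\mathcal U\to\mathbb C^4$ with $F(\bar z)=\overline{F(z)}$ and $f(x+vy)=\rho_v(F(x+\iota y))$ for all $x+\iota y\in\mathcal U$, $v\in\mathbb S$. For every $q\in\mathbb H$, $F(\mathcal U)\cap Z(q)$ is a closed discrete subset of the curve $F(\mathcal U)$ parametrized by $F$, that is, of the set $F(\mathcal U)$ with the topology in which a subset is open if and only if its preimage under $F$ is open in $\mathcal U$. Moreover, unless $F$ is identically equal to $q$, the set $F^{-1}(Z(q))$ of the corresponding parameters is closed and discrete in $\mathcal U$. -/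

import Mathlib

open scoped Quaternion Topology

noncomputable section

namespace SliceRegular

/-- The sphere of imaginary units of the quaternions. -/
def imUnits : Set ℍ[ℝ] := {v | v ^ 2 = -1}

/-- `ℂ⁴`, identified with `ℍ ⊗ ℂ` through the basis `1, i, j, k` of `ℍ`. -/
abbrev C4 : Type := Fin 4 → ℂ

/-- The basis `1, i, j, k` of `ℍ`. -/
def unitBasis : Fin 4 → ℍ[ℝ] := ![⟨1, 0, 0, 0⟩, ⟨0, 1, 0, 0⟩, ⟨0, 0, 1, 0⟩, ⟨0, 0, 0, 1⟩]

/-- The real coordinates of a quaternion, seen as a point of `ℝ⁴ ⊆ ℂ⁴`. -/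
def toC4 (q : ℍ[ℝ]) : C4 := ![(q.re : ℂ), (q.imI : ℂ), (q.imJ : ℂ), (q.imK : ℂ)]

/-- The parametrization `x + ι y ↦ x + v y`, which is both `π (x, y, v)` and `ρ_v (x + ι y)`. -/
def slicePt (z : ℂ) (v : ℍ[ℝ]) : ℍ[ℝ] := (z.re : ℍ[ℝ]) + v * (z.im : ℍ[ℝ])

/-- `Π (z, v) = ρ_v (z)` on `ℂ⁴ = ℍ ⊗ ℂ`: the additive extension of
`z ⊗ q ↦ ρ_v (z) q`. -/
def evalAt (z : C4) (v : ℍ[ℝ]) : ℍ[ℝ] := ∑ m, slicePt (z m) v * unitBasis m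

/-- `Z(q)`: the points `z` of `ℂ⁴` with `Π (z, v) = q` for some imaginary unit `v`. -/
def Z (q : ℍ[ℝ]) : Set C4 := {z | ∃ v ∈ imUnits, evalAt z v = q}

/-- `Φ_q (z) = ∑ (z_m - q_m)²`. -/
def Phi (q : ℍ[ℝ]) (z : C4) : ℂ := ∑ m, (z m - toC4 q m) ^ 2

/-- An open domain of `ℂ`, invariant under conjugation. -/
structure IsSymmDomain (𝒰 : Set ℂ) : Prop where
  isOpen : IsOpen 𝒰
  isConnected : IsConnected 𝒰
  conj_mem : ∀ z ∈ 𝒰, (starRingEnd ℂ) z ∈ 𝒰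

/-- The spherically symmetric set `U = π (𝒰 × 𝕊)` of `ℍ`. -/
def sphericalSet (𝒰 : Set ℂ) : Set ℍ[ℝ] := {p | ∃ z ∈ 𝒰, ∃ v ∈ imUnits, p = slicePt z v}

/-- `f` is a left slice-regular function on `U = π (𝒰 × 𝕊)`:
`f (x + v y) = α (x, y) + v β (x, y)` with `α` even and `β` odd in `y`, differentiable in the real
sense and satisfying the Cauchy-Riemann equations. -/
def IsSliceRegular (𝒰 : Set ℂ) (f : sphericalSet 𝒰 → ℍ[ℝ]) : Prop :=
  ∃ α β : ℂ → ℍ[ℝ],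
    (∀ (z : ℂ) (hz : z ∈ 𝒰) (v : ℍ[ℝ]) (hv : v ∈ imUnits),
      f ⟨slicePt z v, z, hz, v, hv, rfl⟩ = α z + v * β z) ∧
    (∀ z ∈ 𝒰, α ((starRingEnd ℂ) z) = α z ∧ β ((starRingEnd ℂ) z) = -β z) ∧
    DifferentiableOn ℝ α 𝒰 ∧ DifferentiableOn ℝ β 𝒰 ∧
    ∀ z ∈ 𝒰, fderiv ℝ α z 1 = fderiv ℝ β z Complex.I ∧
      fderiv ℝ α z Complex.I = -fderiv ℝ β z 1

/-- `F : 𝒰 → ℂ⁴` is a holomorphic map associated with `f`: it commutes with conjugation and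
`f (x + v y) = ρ_v (F (x + ι y))`. -/
structure IsAssociated (𝒰 : Set ℂ) (f : sphericalSet 𝒰 → ℍ[ℝ]) (F : 𝒰 → C4) : Prop where
  holo : ∃ G : ℂ → C4, DifferentiableOn ℂ G 𝒰 ∧ ∀ z : 𝒰, F z = G z
  conj : ∀ z w : 𝒰, (w : ℂ) = (starRingEnd ℂ) (z : ℂ) →
    ∀ m, F w m = (starRingEnd ℂ) (F z m)
  eval : ∀ (z : 𝒰) (v : ℍ[ℝ]) (hv : v ∈ imUnits),
    f ⟨slicePt z v, z, z.2, v, hv, rfl⟩ = evalAt (F z) v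

/-- The topology of the curve `F(𝒰)` as parametrized by `F : 𝒰 → F(𝒰)`: a subset of `F(𝒰)` is
open exactly when its preimage in `𝒰` is open. -/
abbrev curveTopology {𝒰 : Set ℂ} (F : 𝒰 → C4) : TopologicalSpace (Set.range F) :=
  TopologicalSpace.coinduced (Set.rangeFactorization F) inferInstance

end SliceRegular

end

/-!
Write `z = x + ι y` with `x` and `y` quaternions. Then `ρ_v (z) = x + v y`, so `z ∈ Z(q)` means
that `q - x = v y` for some imaginary unit `v`. The quaternions `v y` are exactly those of norm
`‖y‖` orthogonal to `y` (`exists_imUnits_mul_eq_iff`), and the two conditions on `q - x` are the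
vanishing of the real and of the imaginary part of `Φ_q (z)`. Hence `Z(q)` is a quadratic cone
with vertex `q`.

The complement of the cone `∑ (z_m - a_m)² = 0` is covered by the space of pairs `(z, c)` with `∑
z_m² = exp c` (`ConeLogCover`) through `(z, c) ↦ z + a`. On it `ℤ` acts by deck transformations `c
↦ c + 2πιn`. Dividing `z` by `exp (c / 2)` shows that this space is the product of the quadric `∑
w_m² = 1` and a line, and the quadric retracts onto its real points, a sphere. Spheres of
dimension at least two are simply connected, being covered by the complements of two antipodal
points (`SimplyConnectedSpace.of_union`, the simply connected case of van Kampen's theorem). So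
the covering is universal, and the fundamental group of the complement is its deck group `ℤ`.

The map associated with a slice-regular function `f = α + v β` is `F = α + ι β`; the values of `f`
at `x + v y` and `x - v y` determine it. The parameters of the points of `F(𝒰) ∩ Z(q)` are the
zeros of the holomorphic function `Φ_q ∘ F`. A symmetric domain contains real points, where `F` is
real and `Φ_q ∘ F` is a sum of real squares; if `Φ_q ∘ F` vanishes identically, then `F = q` at
the real points and hence everywhere (`IsAssociated.eq_toC4_of_forall_mem_Z`). Otherwise the zeros
are isolated, by the identity theorem.
-/

/-! ### Simple connectedness from an open cover by two sets -/

section OpenCover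

variable {X : Type*} [TopologicalSpace X]

/-- Two paths with the same endpoints that run inside a simply connected set are homotopic in the
ambient space. -/
theorem IsSimplyConnected.homotopic_of_forall_mem {W : Set X} (hW : IsSimplyConnected W) {x y : X}
    (γ δ : Path x y) (hγ : ∀ t, γ t ∈ W) (hδ : ∀ t, δ t ∈ W) : γ.Homotopic δ := by
  have := hW.simplyConnectedSpace
  lift x to W using by simpa using hγ 0
  lift y to W using by simpa using hγ 1
  let lift (η : Path (x : X) y) (hη : ∀ t, η t ∈ W) : Path x y :=
    { toFun := fun t => ⟨η t, hη t⟩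
      source' := by simp
      target' := by simp }
  exact (SimplyConnectedSpace.paths_homotopic (lift γ hγ) (lift δ hδ)).map
    ⟨Subtype.val, continuous_subtype_val⟩

/-- If the classes `c x` of paths from `x₀` to `x` are compatible with every path that runs
inside one of the sets of an open cover, they are compatible with all paths: subdivide. -/
theorem Path.Homotopic.Quotient.trans_mk_eq_of_open_cover {ι : Type*} {W : ι → Set X}
    (hW : ∀ i, IsOpen (W i)) (hcover : ⋃ i, W i = Set.univ) {x₀ : X}
    (c : ∀ x, Path.Homotopic.Quotient x₀ x)
    (hc : ∀ i {x y : X} (γ : Path x y), (∀ t, γ t ∈ W i) → (c x).trans (.mk γ) = c y)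
    {x y : X} (γ : Path x y) : (c x).trans (.mk γ) = c y := by
  obtain ⟨t, ht0, htm, ⟨n, hn⟩, ht⟩ := exists_monotone_Icc_subset_open_cover_unitInterval
    (c := fun i => γ ⁻¹' W i) (fun i => (hW i).preimage γ.continuous)
    (by rw [← Set.preimage_iUnion, hcover, Set.preimage_univ])
  have key : ∀ m, (c (γ 0)).trans (.mk (γ.subpath 0 (t m))) = c (γ (t m)) := by
    intro m
    induction m with
    | zero => rw [ht0]; simp
    | succ m ih =>
      obtain ⟨i, hi⟩ := ht m
      have hstep := hc i (γ.subpath (t m) (t (m + 1))) fun s => by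
        have : γ.subpath (t m) (t (m + 1)) s ∈ Set.range (γ.subpath (t m) (t (m + 1))) := ⟨s, rfl⟩
        rw [Path.range_subpath_of_le _ _ _ (htm m.le_succ)] at this
        obtain ⟨r, hr, hrs⟩ := this
        rw [← hrs]
        exact hi hr
      rw [← hstep, ← ih, Path.Homotopic.Quotient.trans_assoc]
      congr 1
      rw [← Path.Homotopic.Quotient.mk_trans, Path.Homotopic.Quotient.eq]
      exact ⟨(Path.Homotopy.subpathTransSubpath γ 0 (t m) (t (m + 1))).symm⟩
  have h1 := key n
  rw [hn n le_rfl, Path.subpath_zero_one] at h1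
  have transport : ∀ {x' y' : X} (hx : x' = x) (hy : y' = y),
      (c x').trans (.mk (γ.cast hx hy)) = c y' → (c x).trans (.mk γ) = c y := by
    rintro _ _ rfl rfl h
    exact h
  exact transport γ.source γ.target h1

/-- The simply connected case of the Seifert–van Kampen theorem. -/
theorem SimplyConnectedSpace.of_union {U V : Set X} (hUo : IsOpen U) (hVo : IsOpen V)
    (hU : IsSimplyConnected U) (hV : IsSimplyConnected V) (hUV : IsPathConnected (U ∩ V))
    (hcover : U ∪ V = Set.univ) : SimplyConnectedSpace X := by
  obtain ⟨x₀, hx₀U, hx₀V⟩ := hUV.nonempty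
  have hpc : PathConnectedSpace X := by
    rw [pathConnectedSpace_iff_univ, ← hcover]
    exact hU.isPathConnected.union hV.isPathConnected hUV.nonempty
  let W : Bool → Set X := fun b => cond b U V
  have hW : ∀ b, IsSimplyConnected (W b) := by rintro (_ | _) <;> assumption
  have hx₀ : ∀ b, x₀ ∈ W b := by rintro (_ | _) <;> assumption
  -- A point of `U ∩ V` is joined to `x₀` inside `U ∩ V`, so that its classes through `U` and
  -- through `V` agree.
  have hex : ∀ x, ∃ c : Path.Homotopic.Quotient x₀ x,
      ∀ b (γ : Path x₀ x), (∀ t, γ t ∈ W b) → .mk γ = c := by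
    intro x
    have of_path (δ : Path x₀ x) (hδ : ∀ b, x ∈ W b → ∀ t, δ t ∈ W b) :
        ∃ c : Path.Homotopic.Quotient x₀ x,
          ∀ b (γ : Path x₀ x), (∀ t, γ t ∈ W b) → .mk γ = c :=
      ⟨.mk δ, fun b γ hγ => Path.Homotopic.Quotient.eq.mpr <|
        (hW b).homotopic_of_forall_mem γ δ hγ (hδ b (by simpa using hγ 1))⟩
    by_cases hxU : x ∈ U
    · by_cases hxV : x ∈ V
      · obtain ⟨δ, hδ⟩ := hUV.joinedIn x₀ ⟨hx₀U, hx₀V⟩ x ⟨hxU, hxV⟩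
        exact of_path δ fun b _ t => by cases b; exacts [(hδ t).2, (hδ t).1]
      · obtain ⟨δ, hδ⟩ := hU.isPathConnected.joinedIn x₀ hx₀U x hxU
        exact of_path δ fun b hb t => by cases b; exacts [(hxV hb).elim, hδ t]
    · have hxV : x ∈ V := (hcover.ge (Set.mem_univ x)).resolve_left hxU
      obtain ⟨δ, hδ⟩ := hV.isPathConnected.joinedIn x₀ hx₀V x hxV
      exact of_path δ fun b hb t => by cases b; exacts [hδ t, (hxU hb).elim]
  choose c hc using hex
  have hWo : ∀ b, IsOpen (W b) := by rintro (_ | _) <;> assumption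
  have hWc : ⋃ b, W b = Set.univ := by rw [← hcover, Set.union_eq_iUnion]
  have key : ∀ {x y : X} (γ : Path x y), (c x).trans (.mk γ) = c y := by
    refine Path.Homotopic.Quotient.trans_mk_eq_of_open_cover hWo hWc c fun b x y γ hγ => ?_
    obtain ⟨δ, hδ⟩ := (hW b).isPathConnected.joinedIn x₀ (hx₀ b) x (by simpa using hγ 0)
    rw [← hc x b δ hδ, ← Path.Homotopic.Quotient.mk_trans]
    refine hc y b _ fun t => ?_
    have : δ.trans γ t ∈ Set.range (δ.trans γ) := ⟨t, rfl⟩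
    rw [Path.trans_range] at this
    rcases this with ⟨s, hs⟩ | ⟨s, hs⟩
    · exact hs ▸ hδ s
    · exact hs ▸ hγ s
  rw [simply_connected_iff_paths_homotopic']
  refine ⟨hpc, fun {x y} γ δ => Path.Homotopic.Quotient.eq.mp ?_⟩
  have h := (key γ).trans (key δ).symm
  have h' := congrArg (fun p => (c x).symm.trans p) h
  simpa [← Path.Homotopic.Quotient.trans_assoc] using h'

end OpenCover

/-! ### Spheres of dimension at least two -/

section Sphere

variable {E : Type*} [NormedAddCommGroup E] [InnerProductSpace ℝ E]

/-- The sphere minus a point is an affine space, by the stereographic projection. -/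
theorem isSimplyConnected_sphere_compl_singleton (v : Metric.sphere (0 : E) 1) :
    IsSimplyConnected ({v}ᶜ : Set (Metric.sphere (0 : E) 1)) := by
  have hv : ‖(v : E)‖ = 1 := by simp
  have huniv : IsSimplyConnected (Set.univ : Set (ℝ ∙ (v : E))ᗮ) :=
    (Homeomorph.Set.univ _).toHomotopyEquiv.simplyConnectedSpace
  have h := (isOpenEmbedding_stereographic_symm hv).isEmbedding.isSimplyConnected_image.mpr huniv
  rwa [Set.image_univ, range_stereographic_symm hv v.2] at h

/-- Cover the sphere by the complements of two antipodal points. -/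
theorem simplyConnectedSpace_sphere {n : ℕ} [Fact (Module.finrank ℝ E = n + 1)] (hn : 2 ≤ n) :
    SimplyConnectedSpace (Metric.sphere (0 : E) 1) := by
  have hfr : Module.finrank ℝ E = n + 1 := Fact.out
  have : Nontrivial E := Module.nontrivial_of_finrank_pos (R := ℝ) (by lia)
  obtain ⟨v₀, hv₀⟩ := (NormedSpace.sphere_nonempty (E := E) (x := 0) (r := 1)).mpr zero_le_one
  let v : Metric.sphere (0 : E) 1 := ⟨v₀, hv₀⟩
  have hv : ‖(v : E)‖ = 1 := by simp
  have hne : v ≠ -v := by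
    intro h
    have h2 : (v : E) = -v := congrArg Subtype.val h
    rw [eq_neg_iff_add_eq_zero, ← two_smul ℝ (v : E)] at h2
    simp [show (v : E) = 0 by simpa using h2] at hv
  have hinter : ({v}ᶜ : Set (Metric.sphere (0 : E) 1)) ∩ {-v}ᶜ =
      (stereographic hv).symm '' {0}ᶜ := by
    have h0 : (stereographic hv).symm 0 = -v := by
      rw [← stereographic_apply_neg v]
      exact (stereographic hv).left_inv (by simpa using hne.symm)
    rw [Set.image_compl_eq_range_sdiff_image (isOpenEmbedding_stereographic_symm hv).injective,
      range_stereographic_symm hv v.2, Set.image_singleton, h0]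
    rfl
  refine SimplyConnectedSpace.of_union (U := {v}ᶜ) (V := {-v}ᶜ) isOpen_compl_singleton
    isOpen_compl_singleton (isSimplyConnected_sphere_compl_singleton v)
    (isSimplyConnected_sphere_compl_singleton (-v)) ?_ ?_
  · rw [hinter]
    refine IsPathConnected.image (isPathConnected_compl_singleton_of_one_lt_rank ?_ 0)
      (isOpenEmbedding_stereographic_symm hv).continuous
    have h := Submodule.finrank_orthogonal_span_singleton (𝕜 := ℝ) (E := E) (n := n)
      (v := v) (by rintro h; simp [h] at hv)
    exact_mod_cast Module.lt_rank_of_lt_finrank (n := 1) (by rw [h]; lia)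
  · rw [← Set.compl_inter, Set.compl_univ_iff, Set.singleton_inter_eq_empty]
    exact hne

end Sphere

/-! ### The affine quadric `∑ w_m² = 1` -/

section Quadric

variable (ι : Type*) [Fintype ι]

/-- The complex affine quadric `∑ w_m² = 1`. -/
abbrev AffineQuadric : Type _ := {w : ι → ℂ // ∑ m, w m ^ 2 = 1}

/-- The total space of a covering of the complement of the cone `∑ z_m² = 0`: a point
`z` off the cone together with a logarithm `c` of `∑ z_m²`. -/
abbrev ConeLogCover : Type _ := {p : (ι → ℂ) × ℂ // ∑ m, p.1 m ^ 2 = Complex.exp p.2}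

variable {ι}

namespace AffineQuadric

theorem sum_re_sq (w : AffineQuadric ι) :
    ∑ m, (w.1 m).re ^ 2 = 1 + ∑ m, (w.1 m).im ^ 2 := by
  have h := congrArg Complex.re w.2
  simp only [Complex.re_sum, pow_two, Complex.mul_re, Finset.sum_sub_distrib, Complex.one_re] at h
  simp only [pow_two]
  linarith

theorem sum_re_mul_im (w : AffineQuadric ι) : ∑ m, (w.1 m).re * (w.1 m).im = 0 := by
  have h := congrArg Complex.im w.2
  simp only [Complex.im_sum, pow_two, Complex.mul_im, Finset.sum_add_distrib, Complex.one_im] at h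
  simp only [mul_comm (Complex.im _)] at h
  linarith

/-- The value of `∑ (x_m + ι t y_m)²` at the point `w = x + ι y` of the quadric. -/
noncomputable def scaledNormSq (t : ℝ) (w : AffineQuadric ι) : ℝ :=
  1 + (1 - t ^ 2) * ∑ m, (w.1 m).im ^ 2

theorem scaledNormSq_pos {t : ℝ} (ht : t ∈ unitInterval) (w : AffineQuadric ι) :
    0 < scaledNormSq t w := by
  have h1 : 0 ≤ 1 - t ^ 2 := by nlinarith [ht.1, ht.2]
  have h2 : 0 ≤ ∑ m, (w.1 m).im ^ 2 := Finset.sum_nonneg fun m _ => sq_nonneg _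
  unfold scaledNormSq
  positivity

theorem continuous_scaledNormSq :
    Continuous fun p : unitInterval × AffineQuadric ι => scaledNormSq p.1 p.2 := by
  unfold scaledNormSq
  have h (m : ι) : Continuous fun p : unitInterval × AffineQuadric ι => p.2.1 m :=
    (continuous_apply m).comp (continuous_subtype_val.comp continuous_snd)
  fun_prop

/-- The retraction of the quadric onto its real points scales the imaginary part by `t` and
normalizes. -/
noncomputable def shrink (p : unitInterval × AffineQuadric ι) : AffineQuadric ι where
  val m := ((√(scaledNormSq p.1 p.2))⁻¹ : ℝ) *
    ((p.2.1 m).re + (p.1 : ℝ) * (p.2.1 m).im * Complex.I)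
  property := by
    obtain ⟨t, w⟩ := p
    have hpos := scaledNormSq_pos t.2 w
    have hsum : ∑ m, (((w.1 m).re : ℂ) + (t : ℝ) * (w.1 m).im * Complex.I) ^ 2 =
        scaledNormSq t w := by
      have h1 : ∀ m, (((w.1 m).re : ℂ) + (t : ℝ) * (w.1 m).im * Complex.I) ^ 2 =
          (((w.1 m).re ^ 2 : ℝ) : ℂ) - (t : ℝ) ^ 2 * (((w.1 m).im ^ 2 : ℝ) : ℂ) +
            2 * (t : ℝ) * Complex.I * (((w.1 m).re * (w.1 m).im : ℝ) : ℂ) := by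
        intro m
        push_cast
        linear_combination ((t : ℝ) : ℂ) ^ 2 * ((w.1 m).im : ℂ) ^ 2 * Complex.I_sq
      simp only [h1, Finset.sum_add_distrib, Finset.sum_sub_distrib, ← Finset.mul_sum]
      simp only [← Complex.ofReal_sum, sum_re_sq, sum_re_mul_im, scaledNormSq]
      push_cast
      ring
    simp only [mul_pow, ← Finset.mul_sum, hsum]
    rw [← Complex.ofReal_pow, ← Complex.ofReal_mul, inv_pow, Real.sq_sqrt hpos.le,
      inv_mul_cancel₀ hpos.ne', Complex.ofReal_one]

theorem continuous_shrink : Continuous (shrink (ι := ι)) := by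
  refine Continuous.subtype_mk (continuous_pi fun m => ?_) _
  have hinv : Continuous fun p : unitInterval × AffineQuadric ι => (√(scaledNormSq p.1 p.2))⁻¹ :=
    (Real.continuous_sqrt.comp continuous_scaledNormSq).inv₀ fun p =>
      (Real.sqrt_pos.mpr (scaledNormSq_pos p.1.2 p.2)).ne'
  have hcoord : Continuous fun p : unitInterval × AffineQuadric ι => p.2.1 m :=
    (continuous_apply m).comp (continuous_subtype_val.comp continuous_snd)
  exact (Complex.continuous_ofReal.comp hinv).mul (by fun_prop)

/-- The normalized real part of a point of the quadric. -/
noncomputable def toSphere : C(AffineQuadric ι, Metric.sphere (0 : EuclideanSpace ℝ ι) 1) where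
  toFun w := ⟨WithLp.toLp 2 fun m => ((shrink (0, w)).1 m).re, by
    rw [mem_sphere_zero_iff_norm, EuclideanSpace.norm_eq, Real.sqrt_eq_one]
    have h := sum_re_sq (shrink (0, w))
    have him : ∀ m, ((shrink (0, w)).1 m).im = 0 := fun m => by simp [shrink]
    simpa [him] using h⟩
  continuous_toFun := by
    have h : Continuous fun w : AffineQuadric ι => (shrink ((0 : unitInterval), w)).1 :=
      continuous_subtype_val.comp (continuous_shrink.comp (by fun_prop))
    refine Continuous.subtype_mk ((PiLp.continuous_toLp 2 _).comp (continuous_pi fun m => ?_)) _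
    exact Complex.continuous_re.comp ((continuous_apply m).comp h)

/-- The real points of the quadric form the unit sphere. -/
noncomputable def ofSphere : C(Metric.sphere (0 : EuclideanSpace ℝ ι) 1, AffineQuadric ι) where
  toFun s := ⟨fun m => (s.1 m : ℂ), by
    have h := s.2
    rw [mem_sphere_zero_iff_norm, EuclideanSpace.norm_eq, Real.sqrt_eq_one] at h
    simp only [Real.norm_eq_abs, sq_abs] at h
    simp only [← Complex.ofReal_pow, ← Complex.ofReal_sum, h, Complex.ofReal_one]⟩
  continuous_toFun := by
    refine Continuous.subtype_mk (continuous_pi fun m => Complex.continuous_ofReal.comp ?_) _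
    fun_prop

/-- The quadric retracts onto its real points. -/
noncomputable def homotopyEquivSphere : ContinuousMap.HomotopyEquiv (AffineQuadric ι)
    (Metric.sphere (0 : EuclideanSpace ℝ ι) 1) where
  toFun := toSphere
  invFun := ofSphere
  left_inv := ⟨
    { toFun := shrink
      continuous_toFun := continuous_shrink
      map_zero_left w := by
        ext m
        apply Complex.ext <;> simp [ofSphere, toSphere, shrink]
      map_one_left w := by
        ext m
        apply Complex.ext <;> simp [shrink, scaledNormSq] }⟩
  right_inv := by
    have h : toSphere.comp (ofSphere (ι := ι)) = ContinuousMap.id _ := by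
      ext s m
      simp [ofSphere, toSphere, shrink, scaledNormSq]
    rw [h]

end AffineQuadric

/-! ### The covering of the complement of a quadratic cone -/

namespace ConeLogCover

/-- Dividing by the square root `exp (c / 2)` of `∑ z_m²` identifies the covering space with the
product of the quadric and the line. -/
noncomputable def homeomorphProd : ConeLogCover ι ≃ₜ AffineQuadric ι × ℂ where
  toFun p := (⟨fun m => Complex.exp (-(p.1.2 / 2)) * p.1.1 m, by
    simp only [mul_pow, ← Finset.mul_sum, p.2, ← Complex.exp_nat_mul, ← Complex.exp_add]
    simp [mul_div_cancel₀]⟩, p.1.2)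
  invFun p := ⟨(fun m => Complex.exp (p.2 / 2) * p.1.1 m, p.2), by
    simp only [mul_pow, ← Finset.mul_sum, p.1.2, ← Complex.exp_nat_mul, mul_one]
    simp [mul_div_cancel₀]⟩
  left_inv p := by
    ext m
    · simp [← mul_assoc, ← Complex.exp_add]
    · rfl
  right_inv p := by
    ext m
    · simp [← mul_assoc, ← Complex.exp_add]
    · rfl
  continuous_toFun := by
    refine Continuous.prodMk (Continuous.subtype_mk (by fun_prop) _) (by fun_prop)
  continuous_invFun := by
    have h (m : ι) : Continuous fun p : AffineQuadric ι × ℂ => p.1.1 m :=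
      (continuous_apply m).comp (continuous_subtype_val.comp continuous_fst)
    exact Continuous.subtype_mk (by fun_prop) _

theorem simplyConnectedSpace (hι : 3 ≤ Fintype.card ι) : SimplyConnectedSpace (ConeLogCover ι) := by
  have : Fact (Module.finrank ℝ (EuclideanSpace ℝ ι) = (Fintype.card ι - 1) + 1) :=
    ⟨by rw [finrank_euclideanSpace]; lia⟩
  have := simplyConnectedSpace_sphere (E := EuclideanSpace ℝ ι) (n := Fintype.card ι - 1) (by lia)
  obtain ⟨e⟩ := ContractibleSpace.hequiv_unit ℂ
  exact (((homeomorphProd.toHomotopyEquiv.trans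
    ((ContinuousMap.HomotopyEquiv.refl _).prodCongr e)).trans
    (Homeomorph.prodUnique (AffineQuadric ι) Unit).toHomotopyEquiv).trans
    AffineQuadric.homotopyEquivSphere).simplyConnectedSpace

/-- The deck transformations change the logarithm by multiples of `2πι`. -/
noncomputable instance : AddAction ℤ (ConeLogCover ι) where
  vadd n p := ⟨(p.1.1, n * (2 * Real.pi * Complex.I) + p.1.2), by
    rw [Complex.exp_add, Complex.exp_int_mul_two_pi_mul_I, one_mul]
    exact p.2⟩
  zero_vadd p := by
    ext
    · rfl
    · change ((0 : ℤ) : ℂ) * (2 * Real.pi * Complex.I) + p.1.2 = p.1.2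
      simp
  add_vadd n k p := by
    ext
    · rfl
    · change ((n + k : ℤ) : ℂ) * (2 * Real.pi * Complex.I) + p.1.2 =
        n * (2 * Real.pi * Complex.I) + (k * (2 * Real.pi * Complex.I) + p.1.2)
      push_cast
      ring

theorem coe_vadd (n : ℤ) (p : ConeLogCover ι) :
    (n +ᵥ p).1 = (p.1.1, n * (2 * Real.pi * Complex.I) + p.1.2) := rfl

/-- The covering map onto the complement of the cone with vertex `a`. -/
noncomputable def proj (a : ι → ℂ) (p : ConeLogCover ι) :
    ↥({z : ι → ℂ | ∑ m, (z m - a m) ^ 2 = 0}ᶜ) :=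
  ⟨p.1.1 + a, by simp [p.2, Complex.exp_ne_zero]⟩

theorem continuous_proj (a : ι → ℂ) : Continuous (proj a) :=
  Continuous.subtype_mk (by fun_prop) _

/-- Through every point of the covering passes a section, continuous at its projection, that
follows the principal branch of the logarithm. -/
theorem isOpenMap_proj (a : ι → ℂ) : IsOpenMap (proj a) := by
  refine IsOpenMap.of_sections fun p => ?_
  have hp0 : Complex.exp p.1.2 ≠ 0 := Complex.exp_ne_zero _
  let L : ↥({z : ι → ℂ | ∑ m, (z m - a m) ^ 2 = 0}ᶜ) → ℂ :=
    fun z => (∑ m, (z.1 m - a m) ^ 2) / Complex.exp p.1.2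
  have hL : Continuous L := by
    have h (m : ι) : Continuous fun z : ↥({z : ι → ℂ | ∑ m, (z m - a m) ^ 2 = 0}ᶜ) => z.1 m :=
      (continuous_apply m).comp continuous_subtype_val
    exact (continuous_finsetSum _ fun m _ => ((h m).sub continuous_const).pow 2).div_const _
  have hLp : L (proj a p) = 1 := by
    simp [L, proj, p.2, hp0]
  refine ⟨fun z => ⟨(z.1 - a, p.1.2 + Complex.log (L z)), ?_⟩, ?_, ?_, fun z => ?_⟩
  · have hz : L z ≠ 0 := div_ne_zero z.2 hp0
    rw [Complex.exp_add, Complex.exp_log hz]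
    simp [L, mul_div_cancel₀ _ hp0]
  · refine (Topology.IsInducing.mk rfl :
      Topology.IsInducing (Subtype.val : ConeLogCover ι → _)).continuousAt_iff.mpr ?_
    refine ContinuousAt.prodMk (by fun_prop) ?_
    refine continuousAt_const.add (hL.continuousAt.clog ?_)
    rw [hLp]
    exact Complex.one_mem_slitPlane
  · ext
    · simp [proj]
    · simp [hLp]
  · ext
    simp [proj]

theorem surjective_proj (a : ι → ℂ) : Function.Surjective (proj a) := fun z =>
  ⟨⟨(z.1 - a, Complex.log (∑ m, (z.1 m - a m) ^ 2)), by
    rw [Complex.exp_log z.2]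
    rfl⟩, by ext; simp [proj]⟩

theorem isAddQuotientCoveringMap_proj (a : ι → ℂ) : IsAddQuotientCoveringMap (proj a) ℤ where
  toIsQuotientMap :=
    (isOpenMap_proj a).isQuotientMap (continuous_proj a) (surjective_proj a)
  continuous_const_vadd n := by
    refine Continuous.subtype_mk (f := fun p : ConeLogCover ι =>
      (p.1.1, n * (2 * Real.pi * Complex.I) + p.1.2)) (by fun_prop) _
  apply_eq_iff_mem_orbit {p r} := by
    rw [AddAction.mem_orbit_iff]
    constructor
    · intro h
      have h1 : p.1.1 = r.1.1 := add_right_cancel (congrArg Subtype.val h)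
      have h2 : Complex.exp p.1.2 = Complex.exp r.1.2 := by rw [← p.2, ← r.2, h1]
      obtain ⟨n, hn⟩ := Complex.exp_eq_exp_iff_exists_int.mp h2
      refine ⟨n, Subtype.ext ?_⟩
      rw [coe_vadd, add_comm, ← hn, ← h1]
    · rintro ⟨n, rfl⟩
      rfl
  disjoint p := by
    -- A strip of height `2π` around the logarithm meets none of its translates.
    refine ⟨{r | |r.1.2.im - p.1.2.im| < Real.pi}, ?_, ?_⟩
    · refine IsOpen.mem_nhds (isOpen_lt (by fun_prop) continuous_const) ?_
      simp [Real.pi_pos]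
    · rintro n ⟨_, ⟨r, hr, rfl⟩, hr'⟩
      simp only [Set.mem_ofPred_eq, coe_vadd] at hr hr'
      have him : ((n : ℂ) * (2 * Real.pi * Complex.I) + r.1.2).im =
          n * (2 * Real.pi) + r.1.2.im := by
        simp
      rw [him] at hr'
      rw [abs_lt] at hr hr'
      have hlt : |(n : ℝ)| < 1 := by
        rw [abs_lt]
        constructor <;> nlinarith [Real.pi_pos]
      have : |n| < 1 := by exact_mod_cast hlt
      exact Int.abs_lt_one_iff.mp this

/-- The covering space is simply connected, and its deck group is infinite cyclic. -/
theorem nonempty_fundamentalGroup_mulEquiv (hι : 3 ≤ Fintype.card ι) (a : ι → ℂ)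
    (x : ↥({z : ι → ℂ | ∑ m, (z m - a m) ^ 2 = 0}ᶜ)) :
    Nonempty (FundamentalGroup _ x ≃* Multiplicative ℤ) := by
  have := simplyConnectedSpace hι
  obtain ⟨e, he⟩ := surjective_proj a x
  exact ⟨((isAddQuotientCoveringMap_proj a).fundamentalGroupEquiv ⟨e, he⟩).trans
    MulOpposite.opMulEquiv.symm⟩

theorem pathConnectedSpace_compl_cone (hι : 3 ≤ Fintype.card ι) (a : ι → ℂ) :
    PathConnectedSpace ↥({z : ι → ℂ | ∑ m, (z m - a m) ^ 2 = 0}ᶜ) := by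
  have := simplyConnectedSpace hι
  exact (surjective_proj a).pathConnectedSpace (continuous_proj a)

end ConeLogCover

end Quadric

namespace SliceRegular

/-! ### The zero sets `Z(q)` -/

/-- The real part `x` of `z = x + ι y`, as a quaternion. -/
def reQ (z : C4) : ℍ[ℝ] := ⟨(z 0).re, (z 1).re, (z 2).re, (z 3).re⟩

/-- The imaginary part `y` of `z = x + ι y`, as a quaternion. -/
def imQ (z : C4) : ℍ[ℝ] := ⟨(z 0).im, (z 1).im, (z 2).im, (z 3).im⟩

@[simp] theorem re_reQ (z : C4) : (reQ z).re = (z 0).re := rfl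
@[simp] theorem imI_reQ (z : C4) : (reQ z).imI = (z 1).re := rfl
@[simp] theorem imJ_reQ (z : C4) : (reQ z).imJ = (z 2).re := rfl
@[simp] theorem imK_reQ (z : C4) : (reQ z).imK = (z 3).re := rfl
@[simp] theorem re_imQ (z : C4) : (imQ z).re = (z 0).im := rfl
@[simp] theorem imI_imQ (z : C4) : (imQ z).imI = (z 1).im := rfl
@[simp] theorem imJ_imQ (z : C4) : (imQ z).imJ = (z 2).im := rfl
@[simp] theorem imK_imQ (z : C4) : (imQ z).imK = (z 3).im := rfl

theorem re_unitBasis (m : Fin 4) : (unitBasis m).re = if m = 0 then 1 else 0 := by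
  fin_cases m <;> rfl

theorem imI_unitBasis (m : Fin 4) : (unitBasis m).imI = if m = 1 then 1 else 0 := by
  fin_cases m <;> rfl

theorem imJ_unitBasis (m : Fin 4) : (unitBasis m).imJ = if m = 2 then 1 else 0 := by
  fin_cases m <;> rfl

theorem imK_unitBasis (m : Fin 4) : (unitBasis m).imK = if m = 3 then 1 else 0 := by
  fin_cases m <;> rfl

theorem evalAt_eq (z : C4) (v : ℍ[ℝ]) : evalAt z v = reQ z + v * imQ z := by
  ext <;> simp [evalAt, slicePt, Fin.sum_univ_four, re_unitBasis, imI_unitBasis, imJ_unitBasis,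
    imK_unitBasis] <;> ring

theorem ext_reQ_imQ {z w : C4} (hre : reQ z = reQ w) (him : imQ z = imQ w) : z = w := by
  rw [Quaternion.ext_iff] at hre him
  obtain ⟨a0, a1, a2, a3⟩ := hre
  obtain ⟨b0, b1, b2, b3⟩ := him
  funext m
  fin_cases m
  exacts [Complex.ext a0 b0, Complex.ext a1 b1, Complex.ext a2 b2, Complex.ext a3 b3]

theorem mem_imUnits_iff {v : ℍ[ℝ]} : v ∈ imUnits ↔ v.re = 0 ∧ Quaternion.normSq v = 1 := by
  simp only [imUnits, Set.mem_ofPred_eq, pow_two, Quaternion.ext_iff, Quaternion.normSq_def']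
  simp only [Quaternion.re_mul, Quaternion.imI_mul, Quaternion.imJ_mul, Quaternion.imK_mul,
    Quaternion.re_neg, Quaternion.imI_neg, Quaternion.imJ_neg, Quaternion.imK_neg,
    Quaternion.re_one, Quaternion.imI_one, Quaternion.imJ_one, Quaternion.imK_one]
  constructor
  · rintro ⟨h1, h2, h3, h4⟩
    have hre : v.re = 0 := by
      by_contra hne
      have hI : v.imI = 0 := mul_left_cancel₀ hne (by linarith)
      have hJ : v.imJ = 0 := mul_left_cancel₀ hne (by linarith)
      have hK : v.imK = 0 := mul_left_cancel₀ hne (by linarith)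
      rw [hI, hJ, hK] at h1
      nlinarith
    exact ⟨hre, by rw [hre] at h1 ⊢; linarith⟩
  · rintro ⟨h0, h1⟩
    rw [h0] at h1 ⊢
    refine ⟨by linarith, by ring, by ring, by ring⟩

theorem neg_mem_imUnits {v : ℍ[ℝ]} (hv : v ∈ imUnits) : -v ∈ imUnits := by
  simpa [imUnits] using hv

theorem imUnits_nonempty : imUnits.Nonempty :=
  ⟨unitBasis 1, mem_imUnits_iff.mpr (by simp [Quaternion.normSq_def', re_unitBasis,
    imI_unitBasis, imJ_unitBasis, imK_unitBasis])⟩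

/-- Multiplication by imaginary units moves `b` to exactly the quaternions of the same norm that
are orthogonal to `b`. -/
theorem exists_imUnits_mul_eq_iff (a b : ℍ[ℝ]) :
    (∃ v ∈ imUnits, v * b = a) ↔
      Quaternion.normSq a = Quaternion.normSq b ∧ (a * star b).re = 0 := by
  constructor
  · rintro ⟨v, hv, rfl⟩
    obtain ⟨h0, h1⟩ := mem_imUnits_iff.mp hv
    refine ⟨by rw [map_mul, h1, one_mul], ?_⟩
    rw [mul_assoc, Quaternion.self_mul_star]
    simp [h0]
  · rintro ⟨hn, ho⟩
    rcases eq_or_ne b 0 with rfl | hb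
    · obtain ⟨v, hv⟩ := imUnits_nonempty
      refine ⟨v, hv, ?_⟩
      rw [map_zero, Quaternion.normSq_eq_zero] at hn
      rw [hn, mul_zero]
    · refine ⟨a * b⁻¹, mem_imUnits_iff.mpr ⟨?_, ?_⟩, inv_mul_cancel_right₀ hb a⟩
      · rw [Quaternion.instInv]
        simp [ho]
      · rw [map_mul, map_inv₀, hn, mul_inv_cancel₀ (Quaternion.normSq_ne_zero.mpr hb)]

theorem Phi_re (q : ℍ[ℝ]) (z : C4) :
    (Phi q z).re = Quaternion.normSq (q - reQ z) - Quaternion.normSq (imQ z) := by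
  simp [Phi, toC4, Fin.sum_univ_four, Quaternion.normSq_def', pow_two]
  ring

theorem Phi_im (q : ℍ[ℝ]) (z : C4) :
    (Phi q z).im = -2 * ((q - reQ z) * star (imQ z)).re := by
  simp [Phi, toC4, Fin.sum_univ_four, pow_two]
  ring

theorem Z_eq (q : ℍ[ℝ]) : Z q = {z | Phi q z = 0} := by
  ext z
  have h : z ∈ Z q ↔ ∃ v ∈ imUnits, v * imQ z = q - reQ z := by
    simp only [Z, Set.mem_ofPred_eq, evalAt_eq, eq_sub_iff_add_eq']
  rw [h, exists_imUnits_mul_eq_iff, Set.mem_ofPred_eq, Complex.ext_iff, Phi_re, Phi_im,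
    Complex.zero_re, Complex.zero_im, sub_eq_zero]
  simp

theorem toC4_mem_Z (q : ℍ[ℝ]) : toC4 q ∈ Z q := by
  simp [Z_eq, Phi]

/-- A sum of squares of real numbers vanishes only if each of them does. -/
theorem eq_toC4_of_Phi_eq_zero {q : ℍ[ℝ]} {z : C4} (hz : imQ z = 0) (h : Phi q z = 0) :
    z = toC4 q := by
  have hre := congrArg Complex.re h
  rw [Phi_re, hz, map_zero, sub_zero, Complex.zero_re, Quaternion.normSq_eq_zero,
    sub_eq_zero] at hre
  refine ext_reQ_imQ ?_ ?_
  · rw [← hre]; ext <;> simp [toC4]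
  · rw [hz]; ext <;> simp [toC4]

/-! ### The holomorphic map associated with a slice-regular function -/

/-- The inclusion `ℝ⁴ ⊆ ℂ⁴` as a continuous real-linear map. -/
noncomputable def toC4L : ℍ[ℝ] →L[ℝ] C4 :=
  LinearMap.toContinuousLinearMap
    { toFun := toC4
      map_add' := fun p q => by funext m; fin_cases m <;> simp [toC4]
      map_smul' := fun r q => by funext m; fin_cases m <;> simp [toC4] }

theorem toC4L_apply (q : ℍ[ℝ]) : toC4L q = toC4 q := rfl

theorem reQ_complexify (a b : ℍ[ℝ]) : reQ (toC4L a + Complex.I • toC4L b) = a := by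
  ext <;> simp [toC4L_apply, toC4]

theorem imQ_complexify (a b : ℍ[ℝ]) : imQ (toC4L a + Complex.I • toC4L b) = b := by
  ext <;> simp [toC4L_apply, toC4]

/-- The Cauchy–Riemann equations for the pair `(α, β)` say that `α + ι β` is holomorphic. -/
theorem differentiableOn_complexify {𝒰 : Set ℂ} (h𝒰 : IsOpen 𝒰) {α β : ℂ → ℍ[ℝ]}
    (hα : DifferentiableOn ℝ α 𝒰) (hβ : DifferentiableOn ℝ β 𝒰)
    (hCR : ∀ z ∈ 𝒰, fderiv ℝ α z 1 = fderiv ℝ β z Complex.I ∧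
      fderiv ℝ α z Complex.I = -fderiv ℝ β z 1) :
    DifferentiableOn ℂ (fun z => toC4L (α z) + Complex.I • toC4L (β z)) 𝒰 := by
  intro z hz
  have hαz := (hα.differentiableAt (h𝒰.mem_nhds hz)).hasFDerivAt
  have hβz := (hβ.differentiableAt (h𝒰.mem_nhds hz)).hasFDerivAt
  have hG := (toC4L.hasFDerivAt.comp z hαz).add
    ((toC4L.hasFDerivAt.comp z hβz).const_smul Complex.I)
  have hG' : HasFDerivAt (fun z => toC4L (α z) + Complex.I • toC4L (β z)) _ z := hG
  refine (differentiableAt_complex_iff_differentiableAt_real.mpr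
    ⟨hG'.differentiableAt, ?_⟩).differentiableWithinAt
  rw [hG'.fderiv]
  obtain ⟨h1, h2⟩ := hCR z hz
  simp only [add_apply, smul_apply,
    ContinuousLinearMap.comp_apply, h1, h2, map_neg, smul_add, smul_smul, Complex.I_mul_I,
    neg_smul, one_smul]
  exact add_comm _ _

theorem exists_isAssociated {𝒰 : Set ℂ} (h𝒰 : IsSymmDomain 𝒰) {f : sphericalSet 𝒰 → ℍ[ℝ]}
    (hf : IsSliceRegular 𝒰 f) : ∃ F : 𝒰 → C4, IsAssociated 𝒰 f F := by
  obtain ⟨α, β, hfαβ, hsymm, hα, hβ, hCR⟩ := hf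
  refine ⟨fun z => toC4L (α z) + Complex.I • toC4L (β z),
    ⟨_, differentiableOn_complexify h𝒰.isOpen hα hβ hCR, fun _ => rfl⟩, ?_, ?_⟩
  · intro z w hw m
    obtain ⟨h1, h2⟩ := hsymm z z.2
    simp only [hw, h1, h2]
    fin_cases m <;> simp [toC4L_apply, toC4]
  · intro z v hv
    rw [hfαβ z z.2 v hv, evalAt_eq, reQ_complexify, imQ_complexify]

/-- The values of `f` at `x + v y` and at `x - v y` determine the real and imaginary parts of
`F (x + ι y)`. -/
theorem IsAssociated.unique {𝒰 : Set ℂ} {f : sphericalSet 𝒰 → ℍ[ℝ]} {F G : 𝒰 → C4}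
    (hF : IsAssociated 𝒰 f F) (hG : IsAssociated 𝒰 f G) : F = G := by
  funext z
  obtain ⟨v, hv⟩ := imUnits_nonempty
  have hv0 : v ≠ 0 := by
    rintro rfl
    simpa using (mem_imUnits_iff.mp hv).2
  have h1 := (hF.eval z v hv).symm.trans (hG.eval z v hv)
  have h2 := (hF.eval z (-v) (neg_mem_imUnits hv)).symm.trans
    (hG.eval z (-v) (neg_mem_imUnits hv))
  simp only [evalAt_eq, neg_mul, ← sub_eq_add_neg] at h1 h2
  have hre : reQ (F z) = reQ (G z) := by
    have h3 : (2 : ℝ) • reQ (F z) = (2 : ℝ) • reQ (G z) := by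
      have h4 := congrArg₂ (· + ·) h1 h2
      simpa only [add_add_sub_cancel, ← two_smul ℝ] using h4
    exact smul_right_injective _ (two_ne_zero' ℝ) h3
  rw [hre] at h1
  exact ext_reQ_imQ hre (mul_left_cancel₀ hv0 (add_left_cancel h1))

/-! ### Intersections with `Z(q)` -/

theorem differentiable_Phi (q : ℍ[ℝ]) : Differentiable ℂ (Phi q) := by
  unfold Phi
  fun_prop

/-- An associated map takes real values at the real points of `𝒰`. -/
theorem IsAssociated.imQ_eq_zero {𝒰 : Set ℂ} {f : sphericalSet 𝒰 → ℍ[ℝ]} {F : 𝒰 → C4}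
    (hF : IsAssociated 𝒰 f F) {z : 𝒰} (hz : (z : ℂ).im = 0) : imQ (F z) = 0 := by
  have h := hF.conj z z (Complex.conj_eq_iff_im.mpr hz).symm
  ext <;> exact Complex.conj_eq_iff_im.mp (h _).symm

/-- A symmetric domain contains a real point: the imaginary part takes a value and its negative on
it, hence also the value `0`. -/
theorem IsSymmDomain.exists_real {𝒰 : Set ℂ} (h𝒰 : IsSymmDomain 𝒰) : ∃ z ∈ 𝒰, z.im = 0 := by
  obtain ⟨z, hz⟩ := h𝒰.isConnected.nonempty
  have hpre := h𝒰.isConnected.isPreconnected.image Complex.im Complex.continuous_im.continuousOn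
  have h1 : z.im ∈ Complex.im '' 𝒰 := ⟨z, hz, rfl⟩
  have h2 : -z.im ∈ Complex.im '' 𝒰 := ⟨_, h𝒰.conj_mem z hz, Complex.conj_im z⟩
  have h0 : (0 : ℝ) ∈ Set.uIcc z.im (-z.im) := by
    rw [Set.mem_uIcc]
    rcases le_total 0 z.im with h | h
    · exact Or.inr ⟨by linarith, h⟩
    · exact Or.inl ⟨h, by linarith⟩
  obtain ⟨w, hw, hw0⟩ := hpre.ordConnected.uIcc_subset h1 h2 h0
  exact ⟨w, hw, hw0⟩

/-- If `Φ_q ∘ F` vanishes identically, then `F` equals `q` at the real points of the domain, which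
accumulate, hence everywhere. -/
theorem IsAssociated.eq_toC4_of_forall_mem_Z {𝒰 : Set ℂ} (h𝒰 : IsSymmDomain 𝒰)
    {f : sphericalSet 𝒰 → ℍ[ℝ]} {F : 𝒰 → C4} (hF : IsAssociated 𝒰 f F) {q : ℍ[ℝ]}
    (h : ∀ z, F z ∈ Z q) (z : 𝒰) : F z = toC4 q := by
  obtain ⟨G, hG, hFG⟩ := hF.holo
  obtain ⟨z₀, hz₀, hz₀im⟩ := h𝒰.exists_real
  suffices hEq : Set.EqOn G (fun _ => toC4 q) 𝒰 by rw [hFG, hEq z.2]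
  refine (hG.analyticOnNhd h𝒰.isOpen).eqOn_of_preconnected_of_frequently_eq
    (fun _ _ => analyticAt_const) h𝒰.isConnected.isPreconnected hz₀ ?_
  have hreal : ∀ w ∈ 𝒰, w.im = 0 → G w = toC4 q := fun w hw hw0 => by
    rw [← hFG ⟨w, hw⟩]
    exact eq_toC4_of_Phi_eq_zero (hF.imQ_eq_zero hw0)
      (by simpa [Z_eq] using h ⟨w, hw⟩)
  have htend : Filter.Tendsto (fun t : ℝ => z₀ + t) (𝓝[≠] 0) (𝓝[≠] z₀) := by
    refine tendsto_nhdsWithin_iff.mpr ⟨?_, ?_⟩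
    · have : Continuous fun t : ℝ => z₀ + (t : ℂ) := by fun_prop
      simpa using (this.tendsto 0).mono_left nhdsWithin_le_nhds
    · filter_upwards [self_mem_nhdsWithin] with t ht
      simpa using ht
  refine htend.frequently (Filter.Eventually.frequently ?_)
  filter_upwards [htend.eventually (nhdsWithin_le_nhds (h𝒰.isOpen.mem_nhds hz₀))] with t ht
  exact hreal _ ht (by simp [hz₀im])

/-- By the identity theorem, unless `F` is constantly `q`, the zeros of `Φ_q ∘ F` do not
accumulate in `𝒰`. -/
theorem IsAssociated.isClosed_and_isDiscrete_preimage {𝒰 : Set ℂ} (h𝒰 : IsSymmDomain 𝒰)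
    {f : sphericalSet 𝒰 → ℍ[ℝ]} {F : 𝒰 → C4} (hF : IsAssociated 𝒰 f F) {q : ℍ[ℝ]}
    (hne : ∃ z, F z ≠ toC4 q) : IsClosed (F ⁻¹' Z q) ∧ IsDiscrete (F ⁻¹' Z q) := by
  obtain ⟨z₁, hz₁⟩ : ∃ z, F z ∉ Z q := by
    by_contra! hall
    obtain ⟨z, hz⟩ := hne
    exact hz (hF.eq_toC4_of_forall_mem_Z h𝒰 hall z)
  obtain ⟨G, hG, hFG⟩ := hF.holo
  have han : AnalyticOnNhd ℂ (fun z => Phi q (G z)) 𝒰 :=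
    ((differentiable_Phi q).comp_differentiableOn hG).analyticOnNhd h𝒰.isOpen
  have hz₁' : Phi q (G z₁) ≠ 0 := by
    simpa [Z_eq, hFG] using hz₁
  have hcod := han.preimage_zero_mem_codiscreteWithin hz₁' z₁.2 h𝒰.isConnected
  rw [mem_codiscreteWithin] at hcod
  rw [isClosed_and_discrete_iff]
  intro z
  have h := hcod z z.2
  rw [Filter.disjoint_principal_right] at h ⊢
  have htend : Filter.Tendsto (Subtype.val : 𝒰 → ℂ) (𝓝[≠] z) (𝓝[≠] (z : ℂ)) :=
    continuous_subtype_val.continuousAt.tendsto.inf <| by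
      rw [Filter.tendsto_principal_principal]
      exact fun w hw => fun h => hw (Subtype.ext h)
  filter_upwards [htend h] with w hw hwZ
  refine hw ⟨w.2, fun h => h ?_⟩
  simpa [Z_eq, hFG] using hwZ

/-- Subsets of the curve are closed as soon as their sets of parameters are. If `F` is not
constantly `q`, all subsets of the closed discrete set `F⁻¹(Z(q))` are closed; otherwise the curve
is a single point. -/
theorem IsAssociated.isClosed_and_isDiscrete_curve {𝒰 : Set ℂ} (h𝒰 : IsSymmDomain 𝒰)
    {f : sphericalSet 𝒰 → ℍ[ℝ]} {F : 𝒰 → C4} (hF : IsAssociated 𝒰 f F) (q : ℍ[ℝ]) :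
    IsClosed[curveTopology F] {p : Set.range F | (p : C4) ∈ Z q} ∧
      @IsDiscrete (Set.range F) (curveTopology F) {p : Set.range F | (p : C4) ∈ Z q} := by
  let _ : TopologicalSpace (Set.range F) := curveTopology F
  by_cases hne : ∃ z, F z ≠ toC4 q
  · obtain ⟨hc, hd⟩ := hF.isClosed_and_isDiscrete_preimage h𝒰 hne
    have hsub : ∀ S ⊆ {p : Set.range F | (p : C4) ∈ Z q}, IsClosed S := fun S hS => by
      rw [isClosed_coinduced]
      exact isClosed_of_subset_discrete_closed (fun z hz => hS hz) hd hc
    exact ⟨hsub _ subset_rfl, isDiscrete_iff_forall_mem_exists_isClosed.mpr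
      fun S hS => ⟨S, hsub S hS, Set.inter_eq_left.mpr hS⟩⟩
  · push Not at hne
    have hsubs : Subsingleton (Set.range F) := by
      refine ⟨?_⟩
      rintro ⟨_, z, rfl⟩ ⟨_, w, rfl⟩
      exact Subtype.ext ((hne z).trans (hne w).symm)
    have huniv : {p : Set.range F | (p : C4) ∈ Z q} = Set.univ := by
      refine Set.eq_univ_of_forall ?_
      rintro ⟨_, z, rfl⟩
      change F z ∈ Z q
      rw [hne z]
      exact toC4_mem_Z q
    exact ⟨huniv ▸ isClosed_univ, (Set.subsingleton_of_subsingleton).isDiscrete⟩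

end SliceRegular

theorem mainTheorem2 :
    (∀ q : ℍ[ℝ], SliceRegular.Z q = {z | SliceRegular.Phi q z = 0}) ∧
    (∀ q : ℍ[ℝ],
      PathConnectedSpace ↥((SliceRegular.Z q)ᶜ) ∧
      ∀ x : ↥((SliceRegular.Z q)ᶜ),
        Nonempty (FundamentalGroup ↥((SliceRegular.Z q)ᶜ) x ≃* Multiplicative ℤ)) ∧
    (∀ (𝒰 : Set ℂ), SliceRegular.IsSymmDomain 𝒰 →
      ∀ f : SliceRegular.sphericalSet 𝒰 → ℍ[ℝ], SliceRegular.IsSliceRegular 𝒰 f →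
        (∃! F : 𝒰 → SliceRegular.C4, SliceRegular.IsAssociated 𝒰 f F) ∧
        ∀ F : 𝒰 → SliceRegular.C4, SliceRegular.IsAssociated 𝒰 f F → ∀ q : ℍ[ℝ],
          (IsClosed[SliceRegular.curveTopology F]
              {p : Set.range F | (p : SliceRegular.C4) ∈ SliceRegular.Z q} ∧
            @IsDiscrete (Set.range F) (SliceRegular.curveTopology F)
              {p : Set.range F | (p : SliceRegular.C4) ∈ SliceRegular.Z q}) ∧
          ((∃ z, F z ≠ SliceRegular.toC4 q) →
            IsClosed (F ⁻¹' SliceRegular.Z q) ∧ IsDiscrete (F ⁻¹' SliceRegular.Z q))) := by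
  refine ⟨SliceRegular.Z_eq, fun q => ?_, fun 𝒰 h𝒰 f hf => ⟨?_, fun F hF q =>
    ⟨hF.isClosed_and_isDiscrete_curve h𝒰 q, hF.isClosed_and_isDiscrete_preimage h𝒰⟩⟩⟩
  · rw [SliceRegular.Z_eq q]
    exact ⟨ConeLogCover.pathConnectedSpace_compl_cone (by simp) (SliceRegular.toC4 q),
      ConeLogCover.nonempty_fundamentalGroup_mulEquiv (by simp) (SliceRegular.toC4 q)⟩
  · obtain ⟨F, hF⟩ := SliceRegular.exists_isAssociated h𝒰 hf
    exact ⟨F, hF, fun G hG => hG.unique hF⟩
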